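/- Let $\mathbb N$ be the set of natural numbers and let $[\mathbb N]^\infty$ be the family of infinite subsets of $\mathbb N$. For $a\in[\mathbb N]^\infty$ let $a(n)$ denote the $n$-th element of $a$ in increasing order. For $a,b\in[\mathbb N]^\infty$ write $a\le^* b$ if $\{n : b(n)<a(n)\}$ is finite, and $a\le^\infty b$ if $b\not\le^* a$. A set $A\subseteq[\mathbb N]^\infty$ is unbounded if there is no $b\in[\mathbb N]^\infty$ with $a\le^* b$ for all $a\in A$; $\mathfrak b$ is the minimal cardinality of an unbounded subset of $[\mathbb N]^\infty$. Cardinals are identified with initial ordinals. For an uncountable ordinal $\kappa$, a set $X\subseteq[\mathbb N]^\infty$ with $|X|\ge\kappa$ is a $\kappa$-generalized tower if for each $a\in[\mathbb N]^\infty$ there are $b\in[\mathbb N]^\infty$ and $S\subseteq X$ with $|S|<\kappa$ such that $x\cap\bigcup_{n\in b}[a(n),a(n+1))$ is finite for all $x\in X\setminus S$. A $\kappa$-generalized tower set is a set $X\cup\mathrm{Fin}$, where $X$ is a $\kappa$-generalized tower and $\mathrm{Fin}$ is the family of finite subsets of $\mathbb N$; it is regarded as a subspace of $P(\mathbb N)\cong\{0,1\}^{\mathbb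 N}$ (the Cantor space). A set $X\subseteq[\mathbb N]^\infty$ is a cofinite-scale (also written $\mathrm{cFin}$-scale) if for each $z\in[\mathbb N]^\infty$ there is $t\in[\mathbb N]^\infty$ such that $z\le^\infty t$, and $t\le^* x$ for all but fewer than $\mathfrak b$ elements $x\in X$. A topological space $X$ is Hurewicz if for each sequence $\mathcal U_1,\mathcal U_2,\dotsc$ of open covers of $X$ there are finite sets $\mathcal F_n\subseteq\mathcal U_n$ such that each $x\in X$ belongs to $\bigcup\mathcal F_n$ for all but finitely many $n$. A set of reals is a space homeomorphic to a subset of the real line. A set of reals $X$ is productively Hurewicz if $X\times Y$ is Hurewicz for each Hurewicz set of reals $Y$. Then: (1) Each $\mathfrak b$-generalized tower is a cofinite-scale. (2) Let $\kappa$ be an uncountable ordinal with $\kappa\le\mathfrak b$. Each $\kappa$-generalized tower set is productively Hurewicz. -/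

import Mathlib

open Cardinal

noncomputable section

namespace GenTower

/-- The family of all infinite subsets of `ℕ`. -/
def Roth : Set (Set ℕ) := {a | a.Infinite}

/-- An infinite set `a ⊆ ℕ` viewed as an increasing function: `enum a n` is the `n`-th element
of `a` in increasing order (starting with `n = 0`). -/
def enum (a : Set ℕ) (n : ℕ) : ℕ := Nat.nth (fun i => i ∈ a) n

/-- The relation `a ≤* b`: the set of all `n` with `b(n) < a(n)` is finite. -/
def LeStar (a b : Set ℕ) : Prop := {n : ℕ | enum b n < enum a n}.Finite

/-- The relation `z ≤^∞ t`: it is not the case that `t ≤* z`. -/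
def LeInf (z t : Set ℕ) : Prop := ¬ LeStar t z

/-- A set `A` of infinite sets is bounded if there is one infinite set `b` with `a ≤* b` for all
`a ∈ A`. -/
def IsBounded (A : Set (Set ℕ)) : Prop := ∃ b ∈ Roth, ∀ a ∈ A, LeStar a b

/-- The bounding number: the minimal cardinality of an unbounded set of infinite subsets of `ℕ`. -/
def boundingNumber : Cardinal.{0} :=
  sInf {c : Cardinal.{0} | ∃ A : Set (Set ℕ), A ⊆ Roth ∧ ¬ IsBounded A ∧ #A = c}

/-- The union over `n ∈ b` of the intervals `[a(n), a(n+1))`. -/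
def intervalUnion (a b : Set ℕ) : Set ℕ := ⋃ n ∈ b, Set.Ico (enum a n) (enum a (n + 1))

/-- `X` is a `κ`-generalized tower. Cardinalities are compared with the ordinal `κ` as initial
ordinals. -/
structure IsGeneralizedTower (κ : Ordinal.{0}) (X : Set (Set ℕ)) : Prop where
  subset_roth : X ⊆ Roth
  le_card : κ ≤ (#X).ord
  omits : ∀ a ∈ Roth, ∃ b ∈ Roth, ∃ S : Set (Set ℕ), S ⊆ X ∧ (#S).ord < κ ∧
    ∀ x ∈ X \ S, (x ∩ intervalUnion a b).Finite

/-- `X` is a scale for the filter of cofinite sets: for each `z` there is `t` such that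
`z ≤^∞ t ≤* x` for all but less than `𝔟` elements `x` of `X`. -/
structure IsCofiniteScale (X : Set (Set ℕ)) : Prop where
  subset_roth : X ⊆ Roth
  scale : ∀ z ∈ Roth, ∃ t ∈ Roth, LeInf z t ∧ #{x : Set ℕ | x ∈ X ∧ ¬ LeStar t x} < boundingNumber

/-- A family of subsets of `ℕ` as a subspace of the Cantor space `ℕ → Bool` (product topology),
sets being identified with their characteristic functions. -/
def cantorSubspace (A : Set (Set ℕ)) : Set (ℕ → Bool) := {f | {n : ℕ | f n = true} ∈ A}

/-- The set `X ∪ Fin`, where `Fin` is the family of finite subsets of `ℕ`, as a subspace of the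
Cantor space. -/
def towerSet (X : Set (Set ℕ)) : Set (ℕ → Bool) := cantorSubspace (X ∪ {s | s.Finite})

/-- A family of open sets whose union is the whole space. -/
def IsOpenCoverFamily {X : Type*} [TopologicalSpace X] (U : Set (Set X)) : Prop :=
  (∀ V ∈ U, IsOpen V) ∧ ⋃₀ U = Set.univ

/-- Hurewicz's property: from every sequence of open covers one can select finite subfamilies
whose unions contain each given point for all but finitely many indices. -/
def IsHurewicz (X : Type*) [TopologicalSpace X] : Prop :=
  ∀ U : ℕ → Set (Set X), (∀ n, IsOpenCoverFamily (U n)) →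
    ∃ F : ℕ → Set (Set X), (∀ n, F n ⊆ U n ∧ (F n).Finite) ∧
      ∀ x : X, {n : ℕ | x ∉ ⋃₀ F n}.Finite

/-- A set of reals: a space homeomorphic to a subset of the real line. -/
def IsSetOfReals (Y : Type*) [TopologicalSpace Y] : Prop :=
  ∃ R : Set ℝ, Nonempty (Y ≃ₜ R)

/-- A space is productively Hurewicz if its product with every Hurewicz set of reals is Hurewicz. -/
def IsProductivelyHurewicz (X : Type*) [TopologicalSpace X] : Prop :=
  ∀ (Y : Type) [TopologicalSpace Y], IsSetOfReals Y → IsHurewicz Y → IsHurewicz (X × Y)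

end GenTower

end

namespace GenTower

/-! Both parts apply the tower property to a fast-growing sequence `a`: all but few `x` in `X`
almost miss the blocks `[a n, a (n+1))`, `n ∈ b`. For (1), almost all of `x` lies in the complement
of these blocks, whose long gaps make its enumeration exceed `z` infinitely often
(`leStar_of_almost_subset`). For (2), a Galvin–Miller argument parametrized by `Y`
(`IsHurewicz.exists_absorbing_sequence`) chooses `a` so that finitely many members of each of `U 0,
…, U n` cover the points `(x, y)` with `x` missing block `n`, for each `y` and almost all `n`. Using
block `enum b k ≥ k` for `U k` handles `Fin` and `X \ S`. The remaining fewer than `𝔟` slices `{x} ×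
Y` are handled together by `IsHurewicz.exists_bound`. -/

theorem strictMono_enum {a : Set ℕ} (ha : a.Infinite) : StrictMono (enum a) :=
  Nat.nth_strictMono ha

theorem enum_mem {a : Set ℕ} (ha : a.Infinite) (n : ℕ) : enum a n ∈ a :=
  Nat.nth_mem_of_infinite ha n

theorem enum_range {f : ℕ → ℕ} (hf : StrictMono f) : enum (Set.range f) = f := by
  have hinf : (Set.range f).Infinite := Set.infinite_range_of_injective hf.injective
  exact (StrictMono.range_inj (strictMono_enum hinf) hf).1 (Nat.range_nth_of_infinite hinf)

/-- If `x` is almost contained in `t` and `t'` contains `t` and infinitely many further points,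
then `t' ≤* x`. -/
theorem leStar_of_almost_subset {x t t' : Set ℕ} (hx : x.Infinite) (hxt : (x \ t).Finite)
    (htt' : t ⊆ t') (hinf : (t' \ t).Infinite) : LeStar t' x := by
  classical
  -- `D` has as many points of `t' \ t` as `x` has outside `t`; beyond `max D` they compensate for
  -- the exceptional points of `x`.
  obtain ⟨D, hD, hcard⟩ := hinf.exists_subset_card_eq hxt.toFinset.card
  have ht' : t'.Infinite := hinf.mono Set.sdiff_subset
  have key : ∀ m, D.sup id < m →
      Nat.count (fun i => i ∈ x) m ≤ Nat.count (fun i => i ∈ t') m := by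
    intro m hm
    rw [Nat.count_eq_card_filter_range, Nat.count_eq_card_filter_range]
    have h1 : (Finset.range m).filter (fun i => i ∈ x) ⊆
        (Finset.range m).filter (fun i => i ∈ t) ∪ hxt.toFinset := by
      intro i hi
      by_cases hit : i ∈ t <;> simp_all
    have h2 : (Finset.range m).filter (fun i => i ∈ t) ∪ D ⊆
        (Finset.range m).filter (fun i => i ∈ t') := by
      intro i hi
      rcases Finset.mem_union.1 hi with h | h
      · simp only [Finset.mem_filter] at h ⊢
        exact ⟨h.1, htt' h.2⟩
      · simp only [Finset.mem_filter, Finset.mem_range]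
        exact ⟨(Finset.le_sup (f := id) h).trans_lt hm, (hD h).1⟩
    have hdisj : Disjoint ((Finset.range m).filter (fun i => i ∈ t)) D := by
      rw [Finset.disjoint_left]
      intro i hi hiD
      exact (hD hiD).2 (Finset.mem_filter.1 hi).2
    calc _ ≤ _ := Finset.card_le_card h1
      _ ≤ _ := Finset.card_union_le _ _
      _ = _ := by rw [← hcard, Finset.card_union_of_disjoint hdisj]
      _ ≤ _ := Finset.card_le_card h2
  refine (Set.finite_Iic (D.sup id)).subset fun n hn => ?_
  by_contra hlt
  have hn' : enum x n < enum t' n := hn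
  have hle : n ≤ enum x n := (strictMono_enum hx).le_apply
  have h1 : Nat.count (fun i => i ∈ t') (enum x n + 1) ≤ n := Nat.le_nth_of_count_le hn'
  have h2 : Nat.count (fun i => i ∈ x) (enum x n + 1) = n + 1 :=
    Nat.count_nth_succ fun hf => absurd hf hx
  have h3 := key (enum x n + 1) (by simp only [Set.mem_Iic, not_le] at hlt; omega)
  omega

/-- There is a strictly increasing sequence obtained by iterating steps that depend on the
position. -/
theorem exists_strictMono_iterate (N : ℕ → ℕ → ℕ) (hN : ∀ n m, m < N n m) :
    ∃ a : ℕ → ℕ, StrictMono a ∧ ∀ n, a (n + 1) = N n (a n) :=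
  ⟨fun n => Nat.rec 0 N n, strictMono_nat_of_lt_succ fun _ => hN _ _, fun _ => rfl⟩

theorem IsGeneralizedTower.isCofiniteScale {X : Set (Set ℕ)}
    (hX : IsGeneralizedTower boundingNumber.ord X) : IsCofiniteScale X := by
  classical
  refine ⟨hX.subset_roth, fun z _ => ?_⟩
  obtain ⟨a, ha, hstep⟩ := exists_strictMono_iterate (fun _ m => m + 1 + enum z (m + 1))
    (fun _ m => by omega)
  have hainf : (Set.range a).Infinite := Set.infinite_range_of_injective ha.injective
  obtain ⟨b, hb, S, -, hScard, hS⟩ := hX.omits _ hainf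
  simp only [intervalUnion, enum_range ha] at hS
  have hb : b.Infinite := hb
  set t : Set ℕ := (⋃ n ∈ b, Set.Ico (a n) (a (n + 1)))ᶜ with ht
  -- Open intervals leave the endpoints `a n`, `n ∈ b`, in `t'`: an infinite reserve that absorbs
  -- the finite errors and makes `t'` infinite.
  set t' : Set ℕ := (⋃ n ∈ b, Set.Ioo (a n) (a (n + 1)))ᶜ with ht'
  have htt' : t ⊆ t' := Set.compl_subset_compl.2
    (Set.iUnion₂_mono fun n _ => Set.Ioo_subset_Ico_self)
  have hdiff : a '' b ⊆ t' \ t := by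
    rintro _ ⟨n, hn, rfl⟩
    refine ⟨?_, ?_⟩
    · simp only [ht', Set.mem_compl_iff, Set.mem_iUnion, Set.mem_Ioo, not_exists, not_and]
      intro k _ hk
      rw [ha.lt_iff_lt] at hk ⊢
      omega
    · simp only [ht, Set.mem_compl_iff, not_not, Set.mem_iUnion, Set.mem_Ico]
      exact ⟨n, hn, le_rfl, ha n.lt_succ_self⟩
  have hdinf : (t' \ t).Infinite := (hb.image ha.injective.injOn).mono hdiff
  have ht'inf : t'.Infinite := hdinf.mono Set.sdiff_subset
  refine ⟨t', ht'inf, fun hfin => ?_, ?_⟩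
  -- For `n ∈ b`, `t'` skips `(a n, a (n+1))`, so it has at most `a n + 1` elements below `a (n+1)`.
  -- Hence its value at `a n + 1` is at least `a (n+1) > z (a n + 1)`.
  · refine (hb.image (f := fun n => a n + 1) (fun m _ n _ h => ha.injective (by simpa using h)))
      (hfin.subset ?_)
    rintro _ ⟨n, hn, rfl⟩
    change enum z (a n + 1) < enum t' (a n + 1)
    have hc : Nat.count (fun i => i ∈ t') (a (n + 1)) ≤ a n + 1 := by
      rw [Nat.count_eq_card_filter_range]
      refine (Finset.card_le_card (t := Finset.range (a n + 1)) fun i hi => ?_).trans_eq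
        (Finset.card_range _)
      simp only [Finset.mem_filter, Finset.mem_range] at hi ⊢
      by_contra hlt
      refine hi.2 (Set.mem_iUnion₂.2 ⟨n, hn, ?_, hi.1⟩)
      omega
    have hle : a (n + 1) ≤ enum t' (a n + 1) := (Nat.count_le_iff_le_nth ht'inf).1 hc
    have := hstep n
    omega
  · refine lt_of_le_of_lt (mk_le_mk_of_subset fun x hx => ?_) (ord_lt_ord.1 hScard)
    by_contra hxS
    refine hx.2 (leStar_of_almost_subset (hX.subset_roth hx.1) ?_ htt' hdinf)
    rw [ht, Set.sdiff_compl]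
    exact hS x ⟨hx.1, hxS⟩

/-- Fewer than `𝔟` functions are eventually dominated by a single one. -/
theorem exists_dominating {ι : Type} (hι : #ι < boundingNumber) (g : ι → ℕ → ℕ) :
    ∃ h : ℕ → ℕ, ∀ i, {n | h n < g i n}.Finite := by
  -- Partial sums give strictly increasing majorants, which are the enumerations of their ranges.
  let f : ι → ℕ → ℕ := fun i n => ∑ k ∈ Finset.range (n + 1), (g i k + 1)
  have hf : ∀ i, StrictMono (f i) := fun i => strictMono_nat_of_lt_succ fun n => by
    simp only [f, Finset.sum_range_succ _ (n + 1)]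
    omega
  have hgf : ∀ i n, g i n ≤ f i n := fun i n => by
    simp only [f, Finset.sum_range_succ]
    omega
  let A : Set (Set ℕ) := Set.range fun i => Set.range (f i)
  have hA : IsBounded A := by
    by_contra hA
    have hsub : A ⊆ Roth := by
      rintro _ ⟨i, rfl⟩
      exact Set.infinite_range_of_injective (hf i).injective
    exact absurd (hι.trans_le (csInf_le' ⟨A, hsub, hA, rfl⟩)) (not_lt.2 mk_range_le)
  obtain ⟨b, -, hb⟩ := hA
  refine ⟨enum b, fun i => (hb _ ⟨i, rfl⟩).subset fun n hn => ?_⟩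
  simp only [Set.mem_ofPred_eq, enum_range (hf i)] at hn ⊢
  exact hn.trans_le (hgf i n)

/-- Fewer than `𝔟` continuous images of a Hurewicz space are handled simultaneously by one
selection from a sequence of countable open covers. -/
theorem IsHurewicz.exists_bound {Y Z : Type} [TopologicalSpace Y] [TopologicalSpace Z]
    (hY : IsHurewicz Y) {ι : Type} (hι : #ι < boundingNumber) (f : ι → Y → Z)
    (hf : ∀ i, Continuous (f i)) (V : ℕ → ℕ → Set Z) (hVo : ∀ n j, IsOpen (V n j))
    (hV : ∀ n, ⋃ j, V n j = Set.univ) :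
    ∃ h : ℕ → ℕ, ∀ i y, {n | ∀ j ≤ h n, f i y ∉ V n j}.Finite := by
  have hg : ∀ i, ∃ g : ℕ → ℕ, ∀ y, {n | ∀ j ≤ g n, f i y ∉ V n j}.Finite := by
    intro i
    obtain ⟨F, hF, hFy⟩ := hY (fun n => Set.range fun j => f i ⁻¹' V n j) (by
      refine fun n => ⟨?_, ?_⟩
      · rintro _ ⟨j, rfl⟩
        exact (hVo n j).preimage (hf i)
      · rw [Set.sUnion_range, ← Set.preimage_iUnion, hV, Set.preimage_univ])
    have hJ : ∀ n, ∃ J : Set ℕ, J.Finite ∧ F n ⊆ (fun j => f i ⁻¹' V n j) '' J := fun n => by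
      have := (hF n).2.to_subtype
      choose j hj using fun W : F n => (hF n).1 W.2
      exact ⟨Set.range j, Set.finite_range j, fun W hW => ⟨j ⟨W, hW⟩, ⟨_, rfl⟩, hj ⟨W, hW⟩⟩⟩
    choose J hJf hJ using hJ
    choose g hg using fun n => (hJf n).bddAbove
    refine ⟨g, fun y => (hFy y).subset fun n hn => ?_⟩
    rintro ⟨W, hW, hyW⟩
    obtain ⟨j, hj, rfl⟩ := hJ n hW
    exact hn j (hg n hj) hyW
  choose g hg using hg
  obtain ⟨h, hh⟩ := exists_dominating hι g
  refine ⟨h, fun i y => ((hg i y).union (hh i)).subset fun n hn => ?_⟩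
  by_cases hlt : h n < g i n
  · exact Or.inr hlt
  · exact Or.inl fun j hj => hn j (hj.trans (not_lt.1 hlt))

/-- `Absorbs U n m V` means that for some `N > m` and finite subfamilies of `U 0, …, U n`, each
of these subfamilies covers all `(x, y)` with `y ∈ V` and `x` disjoint from `[m, N)`. -/
def Absorbs {T : Set (ℕ → Bool)} {Y : Type} (U : ℕ → Set (Set (T × Y))) (n m : ℕ)
    (V : Set Y) : Prop :=
  ∃ N > m, ∃ G : ℕ → Set (Set (T × Y)), (∀ k, G k ⊆ U k ∧ (G k).Finite) ∧
    ∀ k ≤ n, ∀ x : T, (∀ i, m ≤ i → i < N → x.1 i = false) → ∀ y ∈ V, (x, y) ∈ ⋃₀ G k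

theorem Absorbs.sUnion {T : Set (ℕ → Bool)} {Y : Type} {U : ℕ → Set (Set (T × Y))} {n m : ℕ}
    {F : Set (Set Y)} (hF : F.Finite) (h : ∀ V ∈ F, Absorbs U n m V) : Absorbs U n m (⋃₀ F) := by
  induction F, hF using Set.Finite.induction_on with
  | empty => exact ⟨m + 1, m.lt_succ_self, fun _ => ∅, by simp, by simp⟩
  | @insert V F _ _ ih =>
    obtain ⟨N, hN, G, hG, hV⟩ := h V (Set.mem_insert _ _)
    obtain ⟨N', -, G', hG', hF⟩ := ih fun W hW => h W (Set.mem_insert_of_mem _ hW)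
    refine ⟨max N N', lt_max_of_lt_left hN, fun k => G k ∪ G' k, fun k =>
      ⟨Set.union_subset (hG k).1 (hG' k).1, (hG k).2.union (hG' k).2⟩, fun k hk x hx y hy => ?_⟩
    rw [Set.sUnion_union]
    rw [Set.sUnion_insert] at hy
    exact hy.imp
      (hV k hk x (fun i h1 h2 => hx i h1 (lt_max_of_lt_left h2)) y)
      (hF k hk x (fun i h1 h2 => hx i h1 (lt_max_of_lt_right h2)) y)

/-- A neighbourhood of a point of `T × Y` contains a product of a cylinder and an open set. -/
theorem exists_cylinder_prod_subset {T : Set (ℕ → Bool)} {Y : Type} [TopologicalSpace Y]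
    {W : Set (T × Y)} (hW : IsOpen W) {p : T} {y : Y} (hp : (p, y) ∈ W) :
    ∃ N : ℕ, ∃ V : Set Y, IsOpen V ∧ y ∈ V ∧
      ∀ x : T, (∀ i < N, x.1 i = p.1 i) → ∀ y' ∈ V, (x, y') ∈ W := by
  obtain ⟨A, V, hA, hV, hpA, hyV, hAV⟩ := isOpen_prod_iff.1 hW p y hp
  obtain ⟨B, hB, rfl⟩ := isOpen_induced_iff.1 hA
  obtain ⟨I, u, hu, hIu⟩ := isOpen_pi_iff.1 hB p.1 hpA
  refine ⟨I.sup id + 1, V, hV, hyV, fun x hx y' hy' => hAV ⟨hIu fun i hi => ?_, hy'⟩⟩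
  rw [hx i (Nat.lt_succ_of_le (Finset.le_sup (f := id) hi))]
  exact (hu i hi).2

/-- If `x` vanishes on `[m, N)`, then below `N` it agrees with its trace on `[0, m)`. There are only
finitely many traces `s`, so finitely many neighbourhoods of points `(s, y)` suffice. -/
theorem exists_absorbing_one {T : Set (ℕ → Bool)} {Y : Type} [TopologicalSpace Y]
    (hT : ∀ s : Finset ℕ, (fun i => decide (i ∈ s)) ∈ T) {U : Set (Set (T × Y))}
    (hU : IsOpenCoverFamily U) (m : ℕ) (y : Y) :
    ∃ N : ℕ, ∃ V : Set Y, IsOpen V ∧ y ∈ V ∧ ∃ G ⊆ U, G.Finite ∧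
      ∀ x : T, (∀ i, m ≤ i → i < N → x.1 i = false) → ∀ y' ∈ V, (x, y') ∈ ⋃₀ G := by
  have h : ∀ s : Finset ℕ, ∃ N : ℕ, ∃ V : Set Y, ∃ W ∈ U, IsOpen V ∧ y ∈ V ∧
      ∀ x : T, (∀ i < N, x.1 i = decide (i ∈ s)) → ∀ y' ∈ V, (x, y') ∈ W := fun s => by
    have hmem : ((⟨_, hT s⟩, y) : T × Y) ∈ ⋃₀ U := by rw [hU.2]; trivial
    obtain ⟨W, hWU, hW⟩ := hmem
    obtain ⟨N, V, h1, h2, h3⟩ := exists_cylinder_prod_subset (hU.1 W hWU) hW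
    exact ⟨N, V, W, hWU, h1, h2, h3⟩
  choose N V W hWU hVo hyV hVW using h
  let P := (Finset.range m).powerset
  refine ⟨P.sup N, ⋂ s ∈ P, V s, isOpen_biInter_finset fun s _ => hVo s,
    Set.mem_iInter₂.2 fun s _ => hyV s, W '' P, ?_, P.finite_toSet.image _, fun x hx y' hy' => ?_⟩
  · rintro _ ⟨s, -, rfl⟩
    exact hWU s
  · let s := (Finset.range m).filter fun i => x.1 i = true
    have hs : s ∈ P := Finset.mem_powerset.2 (Finset.filter_subset _ _)
    refine ⟨W s, ⟨s, hs, rfl⟩, hVW s x (fun i hi => ?_) y' (Set.mem_iInter₂.1 hy' s hs)⟩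
    by_cases him : i < m
    · simp [s, him]
    · rw [hx i (not_lt.1 him) (hi.trans_le (Finset.le_sup hs))]
      simp [s, him]

theorem exists_absorbs {T : Set (ℕ → Bool)} {Y : Type} [TopologicalSpace Y]
    (hT : ∀ s : Finset ℕ, (fun i => decide (i ∈ s)) ∈ T) {U : ℕ → Set (Set (T × Y))}
    (hU : ∀ n, IsOpenCoverFamily (U n)) (n m : ℕ) (y : Y) :
    ∃ V, IsOpen V ∧ y ∈ V ∧ Absorbs U n m V := by
  choose N V hVo hyV G hGU hGf hG using fun k => exists_absorbing_one hT (hU k) m y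
  refine ⟨⋂ k ∈ Finset.range (n + 1), V k, isOpen_biInter_finset fun k _ => hVo k,
    Set.mem_iInter₂.2 fun k _ => hyV k, m + 1 + (Finset.range (n + 1)).sup N, by omega, G,
    fun k => ⟨hGU k, hGf k⟩, fun k hk x hx y' hy' => ?_⟩
  have hk' : k ∈ Finset.range (n + 1) := Finset.mem_range.2 (Nat.lt_succ_of_le hk)
  refine hG k x (fun i h1 h2 => hx i h1 ?_) y' (Set.mem_iInter₂.1 hy' k hk')
  have := Finset.le_sup (f := N) hk'
  omega

/-- A Galvin–Miller type lemma with a Hurewicz parameter space. -/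
theorem IsHurewicz.exists_absorbing_sequence {T : Set (ℕ → Bool)} {Y : Type} [TopologicalSpace Y]
    (hY : IsHurewicz Y) (hT : ∀ s : Finset ℕ, (fun i => decide (i ∈ s)) ∈ T)
    {U : ℕ → Set (Set (T × Y))} (hU : ∀ n, IsOpenCoverFamily (U n)) :
    ∃ a : ℕ → ℕ, StrictMono a ∧ ∃ G : ℕ → ℕ → Set (Set (T × Y)),
      (∀ n k, G n k ⊆ U k ∧ (G n k).Finite) ∧
      ∀ y, {n | ¬ ∀ k ≤ n, ∀ x : T, (∀ i, a n ≤ i → i < a (n + 1) → x.1 i = false) →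
        (x, y) ∈ ⋃₀ G n k}.Finite := by
  -- The covers are indexed by all pairs `(n, m)`, so the selection precedes `a`; afterwards `a`
  -- follows the resulting bounds `N`, and only the pairs `(n, a n)` are used.
  obtain ⟨F, hF, hFy⟩ := hY
    (fun j => {V | IsOpen V ∧ Absorbs U j.unpair.1 j.unpair.2 V})
    (fun j => ⟨fun V hV => hV.1, Set.eq_univ_of_forall fun y => by
      obtain ⟨V, h1, h2, h3⟩ := exists_absorbs hT hU j.unpair.1 j.unpair.2 y
      exact ⟨V, ⟨h1, h3⟩, h2⟩⟩)
  have hA : ∀ n m, Absorbs U n m (⋃₀ F (Nat.pair n m)) := fun n m =>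
    Absorbs.sUnion (hF _).2 fun V hV => by simpa using ((hF _).1 hV).2
  choose N hN G hG hcov using hA
  obtain ⟨a, ha, hstep⟩ := exists_strictMono_iterate N hN
  refine ⟨a, ha, fun n => G n (a n), fun n => hG n (a n), fun y => ?_⟩
  have hinj : Function.Injective fun n => Nat.pair n (a n) := fun n n' h =>
    (Nat.pair_eq_pair.1 h).1
  refine ((hFy y).preimage hinj.injOn).subset fun n hn => ?_
  by_contra hy
  refine hn fun k hk x hx => hcov n (a n) k hk x (fun i h1 h2 => hx i h1 ?_) y (not_not.1 hy)
  rwa [hstep]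

theorem IsGeneralizedTower.isProductivelyHurewicz_towerSet {κ : Ordinal.{0}}
    (hκ : κ ≤ boundingNumber.ord) {X : Set (Set ℕ)} (hX : IsGeneralizedTower κ X) :
    IsProductivelyHurewicz (towerSet X) := by
  intro Y _ hYR hY U hU
  obtain ⟨R, ⟨e⟩⟩ := hYR
  have : SecondCountableTopology Y := e.secondCountableTopology
  rcases isEmpty_or_nonempty (towerSet X × Y) with hempty | hne
  · exact ⟨fun _ => ∅, fun _ => ⟨Set.empty_subset _, Set.finite_empty⟩, fun p => hempty.elim p⟩
  have hT : ∀ s : Finset ℕ, (fun i => decide (i ∈ s)) ∈ towerSet X := fun s =>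
    Or.inr (s.finite_toSet.subset fun i hi => by simpa using hi)
  obtain ⟨a, ha, G, hG, hGy⟩ := hY.exists_absorbing_sequence hT hU
  obtain ⟨b, hb, S, hSX, hScard, hS⟩ := hX.omits (Set.range a)
    (Set.infinite_range_of_injective ha.injective)
  have hb : b.Infinite := hb
  simp only [intervalUnion, enum_range ha] at hS
  have hcount : ∀ n, ∃ V : ℕ → Set (towerSet X × Y), (∀ j, V j ∈ U n) ∧
      ⋃ j, V j = Set.univ := fun n => by
    obtain ⟨C, hC, hCU, hCeq⟩ := TopologicalSpace.isOpen_sUnion_countable (U n) (hU n).1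
    rw [(hU n).2] at hCeq
    have hCne : C.Nonempty := by
      by_contra h
      rw [Set.not_nonempty_iff_eq_empty] at h
      rw [h, Set.sUnion_empty] at hCeq
      exact Set.empty_ne_univ hCeq
    obtain ⟨V, rfl⟩ := hC.exists_eq_range hCne
    exact ⟨V, fun j => hCU ⟨j, rfl⟩, by rwa [Set.sUnion_range] at hCeq⟩
  choose V hVU hV using hcount
  obtain ⟨h, hh⟩ := hY.exists_bound (ι := {x : towerSet X // {n | x.1 n = true} ∈ S})
    (f := fun x y => (x.1, y)) (hι := by
      refine lt_of_le_of_lt ?_ (ord_lt_ord.1 (hScard.trans_le hκ))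
      refine mk_le_of_injective (f := fun x => (⟨{n | x.1.1 n = true}, x.2⟩ : S)) ?_
      intro x x' hxx'
      have h1 : {n | x.1.1 n = true} = {n | x'.1.1 n = true} := congrArg Subtype.val hxx'
      refine Subtype.ext (Subtype.ext (funext fun n => Bool.eq_iff_iff.2 ?_))
      exact Set.ext_iff.1 h1 n)
    (hf := fun x => by fun_prop) V (fun n j => (hU n).1 _ (hVU n j)) hV
  -- The first family serves `x ∉ S`, the second `x ∈ S`.
  refine ⟨fun k => G (enum b k) k ∪ V k '' Set.Iic (h k), fun k =>
    ⟨Set.union_subset (hG _ k).1 ?_, (hG _ k).2.union ((Set.finite_Iic _).image _)⟩, ?_⟩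
  · rintro _ ⟨j, -, rfl⟩
    exact hVU k j
  rintro ⟨x, y⟩
  by_cases hxS : {n | x.1 n = true} ∈ S
  · refine (hh ⟨x, hxS⟩ y).subset fun n hn j hj hmem => hn ?_
    exact ⟨V n j, Or.inr ⟨j, hj, rfl⟩, hmem⟩
  · have hfin : ({n | x.1 n = true} ∩ ⋃ n ∈ b, Set.Ico (a n) (a (n + 1))).Finite := by
      rcases x.2 with hxX | hxF
      · exact hS _ ⟨hxX, hxS⟩
      · exact Set.Finite.subset hxF Set.inter_subset_left
    obtain ⟨M, hM⟩ := hfin.bddAbove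
    have hbm := strictMono_enum hb
    -- A point of `x` in block `enum b k` is at least `a (enum b k) ≥ k`, so for `k > M` the block
    -- is missed.
    refine (((hGy y).preimage hbm.injective.injOn).union (Set.finite_Iic M)).subset
      fun k hk => ?_
    by_contra hcon
    simp only [Set.mem_union, Set.mem_preimage, Set.mem_ofPred_eq, Set.mem_Iic, not_or, not_not,
      not_le] at hcon
    refine hk (Set.sUnion_mono Set.subset_union_left
      (hcon.1 k hbm.le_apply x fun i h1 h2 => ?_))
    by_contra hi
    have hiM := hM ⟨by simpa using hi, Set.mem_iUnion₂.2 ⟨enum b k, enum_mem hb k, h1, h2⟩⟩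
    have h3 : k ≤ enum b k := hbm.le_apply
    have h4 : enum b k ≤ a (enum b k) := ha.le_apply
    omega

end GenTower

theorem mainTheorem9 :
    (∀ X : Set (Set ℕ), GenTower.IsGeneralizedTower GenTower.boundingNumber.ord X →
      GenTower.IsCofiniteScale X) ∧
    (∀ κ : Ordinal.{0}, Cardinal.aleph0 < κ.card → κ ≤ GenTower.boundingNumber.ord →
      ∀ X : Set (Set ℕ), GenTower.IsGeneralizedTower κ X →
        GenTower.IsProductivelyHurewicz (GenTower.towerSet X)) :=
  ⟨fun _ hX => hX.isCofiniteScale, fun _ _ hκ _ hX => hX.isProductivelyHurewicz_towerSet hκ⟩
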